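/- **Theorem.** For every $n \ge 1$, the cop number of the $n$-dimensional flat torus $T^n = S^1\times\cdots\times S^1 = \mathbb{R}^n/\mathbb{Z}^n$ (with the metric $d$ induced by the Euclidean metric of $\mathbb{R}^n$) is $c(T^n) = 2$. Here the game of Cops and Robber with $k \ge 1$ cops on a compact geodesic space $(X,d)$ is the following. The robber's player chooses initial positions $r^0 \in X$ and $c^0 = (c^0_1,\dots,c^0_k) \in X^k$ and an agility function $\tau\colon \{1,2,\dots\} \to [0,\infty)$ with $\sum_{m\ge1} \tau(m) = \infty$. In step $m \ge 1$ the robber first moves to a point $r^m$ with $d(r^{m-1}, r^m) \le \tau(m)$, and then each cop, seeing $r^m$, moves to a point $c_i^m$ with $d(c_i^{m-1}, c_i^m) \le \tau(m)$. The value of a play is $\inf_{m \ge 0}\min_{i} d(r^m, c^m_i)$. A strategy of the robber is a function $s\colon X\times X^k\times[0,\infty)\to X$ with $d(r, s(r,c,t)) \le t$, played by $r^m = s(r^{m-1}, c^{m-1}, \tau(m))$. A strategy of the cops is a function $q\colon X\times X^k\times[0,\infty)\to X^k$ with $d(c_i, q(r',c,t)_i) \le t$ for all $i$, played by $c^m =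 q(r^m, c^{m-1}, \tau(m))$. Let $v_\tau(s,q)$ be the value of the resulting play, where the initial position is regarded as part of $s$. The guaranteed outcomes for the cops and for the robber are $$\mathrm{Val}_C = \sup_\tau\,\sup_s\,\inf_q\, v_\tau(s,q), \qquad \mathrm{Val}_R = \sup_\tau\,\inf_q\,\sup_s\, v_\tau(s,q).$$ The $k$ cops win the game on $X$ if $\mathrm{Val}_C = 0$, and $c(X)$ is the least $k \ge 1$ such that $k$ cops win the game on $X$ ($c(X)=\infty$ if there is no such $k$). The number of cops is the same when winning is measured by the other outcome: the least $k \ge 1$ for which $\mathrm{Val}_R = 0$ on $T^n$ is also $2$. -/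

import Mathlib

open scoped NNReal ENNReal

namespace CopsRobber

/-- An agility function: `τ n` is the length of the `(n+1)`-st step of the game, and the total
duration `∑ τ n` is infinite. -/
def IsAgility (τ : ℕ → ℝ≥0) : Prop := ∑' n, (τ n : ℝ≥0∞) = ⊤

/-- A strategy of the robber against `k` cops: from the current position `(r, c)` and the length
`t` of the step it produces the new position of the robber, at distance at most `t` from `r`. -/
structure RobberStrategy (X : Type*) [MetricSpace X] (k : ℕ) where
  move : X → (Fin k → X) → ℝ≥0 → X
  dist_move_le : ∀ r c t, dist r (move r c t) ≤ t

/-- A strategy of `k` cops: from the new position `r'` of the robber, the current positions `c` of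
the cops and the length `t` of the step it produces the new positions of the cops, the `i`-th one
at distance at most `t` from `c i`. -/
structure CopStrategy (X : Type*) [MetricSpace X] (k : ℕ) where
  move : X → (Fin k → X) → ℝ≥0 → (Fin k → X)
  dist_move_le : ∀ r' c t i, dist (c i) (move r' c t i) ≤ t

variable {X : Type*} [MetricSpace X] {k : ℕ}

/-- The position `(r, c)` after `n` steps, when the game starts in `p`, has agility `τ`, and is
played with the strategies `s` and `q`. In each step the robber moves first. -/
def position (τ : ℕ → ℝ≥0) (p : X × (Fin k → X)) (s : RobberStrategy X k) (q : CopStrategy X k) :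
    ℕ → X × (Fin k → X)
  | 0 => p
  | n + 1 =>
    let x := position τ p s q n
    let r' := s.move x.1 x.2 (τ n)
    (r', q.move r' x.2 (τ n))

/-- The value of the game: the infimum over all `n ≥ 0` of the distance from the robber to the
nearest cop after `n` steps. A play in which the robber is caught has value `0`, whether or not it
is continued after the capture, so the play need not be stopped. -/
noncomputable def value (τ : ℕ → ℝ≥0) (p : X × (Fin k → X)) (s : RobberStrategy X k)
    (q : CopStrategy X k) : ℝ≥0∞ :=
  ⨅ n : ℕ, ⨅ i : Fin k, edist (position τ p s q n).1 ((position τ p s q n).2 i)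

variable (X k)

/-- The guaranteed outcome for the cops, `sup_τ sup_s inf_q v_τ(s, q)`; the robber chooses the
initial position along with his strategy. -/
noncomputable def valC : ℝ≥0∞ :=
  ⨆ (τ : ℕ → ℝ≥0) (_ : IsAgility τ),
    ⨆ (p : X × (Fin k → X)) (s : RobberStrategy X k), ⨅ q : CopStrategy X k, value τ p s q

/-- The guaranteed outcome for the robber, `sup_τ inf_q sup_s v_τ(s, q)`; the robber chooses the
initial position along with his strategy. -/
noncomputable def valR : ℝ≥0∞ :=
  ⨆ (τ : ℕ → ℝ≥0) (_ : IsAgility τ),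
    ⨅ q : CopStrategy X k, ⨆ (p : X × (Fin k → X)) (s : RobberStrategy X k), value τ p s q

/-- `k` cops win the game on `X`. -/
def CopsWin : Prop := valC X k = 0

/-- The cop number `c(X)`: the least `k ≥ 1` such that `k` cops win the game on `X`, and `⊤` if
there is no such `k`. -/
noncomputable def copNumber : ℕ∞ := ⨅ (k : ℕ) (_ : 1 ≤ k ∧ CopsWin X k), (k : ℕ∞)

end CopsRobber

/-- The `n`-dimensional flat torus `S¹ × ⋯ × S¹ = ℝⁿ / ℤⁿ`: each factor is the circle `ℝ / ℤ` with
its arc-length metric, and distances in the factors are combined by the Euclidean (`ℓ²`) formula,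
which gives the intrinsic metric of the flat torus. -/
abbrev FlatTorus (n : ℕ) : Type := PiLp 2 (fun _ : Fin n => AddCircle (1 : ℝ))

open scoped RealInnerProductSpace
-- Pursuit by two cops in Euclidean space
section
variable {E : Type*} [NormedAddCommGroup E] [InnerProductSpace ℝ E]

/-! One cop fails because translation by the point with all coordinates `1/2` moves every point by
at least `1/2`: a robber who follows the translate of the cop is never approached
(`le_valC_one_of_isometry`). Since `valC ≤ valR`, both upper bounds follow once two cops force `valR
= 0`.

Lift the vectors from the cops to the robber to vectors `x`, `y` in Euclidean space, and let both
cops run straight at him. The first cop gains unless the robber flees almost exactly along the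
direction `u` of `x`; in that case the second cop gains, provided `⟪y, u⟫ ≤ 0`, that is, if it does
not lie behind him. The covering supplies such a `y`: some lift lies within `n` of `-L u` for any
`L`. The term `K (‖y‖ + ⟪y, u⟫)` penalizes badly placed lifts and hardly grows under pursuit, while
a large `M` makes any deviation from `u` pay for the errors.

Hence, outside distance `ε`, the potential drops in proportion to the step length
(`pairPotential_pursue_le`). Taking its infimum over lifts lets the lift be rechosen at each step
(`norm_le_and_inner_nonpos_of_lift`). As the total duration is infinite, the robber comes within `ε`
(`valR_le_of_potential`). -/

/-- The unit vector in the direction of `x`. -/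
noncomputable def unitDir (x : E) : E := ‖x‖⁻¹ • x

theorem norm_unitDir_le (x : E) : ‖unitDir x‖ ≤ 1 := by
  unfold unitDir
  rw [norm_smul, norm_inv, norm_norm]
  exact inv_mul_le_one

theorem norm_smul_unitDir (x : E) : ‖x‖ • unitDir x = x := by
  rcases eq_or_ne x 0 with rfl | h
  · simp
  · unfold unitDir
    rw [smul_smul, mul_inv_cancel₀ (norm_ne_zero_iff.2 h), one_smul]

theorem norm_unitDir {x : E} (h : x ≠ 0) : ‖unitDir x‖ = 1 := by
  unfold unitDir
  rw [norm_smul, norm_inv, norm_norm, inv_mul_cancel₀ (norm_ne_zero_iff.2 h)]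

theorem inner_unitDir_self (x : E) : ⟪x, unitDir x⟫ = ‖x‖ := by
  rcases eq_or_ne x 0 with rfl | h
  · simp
  · unfold unitDir
    rw [real_inner_smul_right, real_inner_self_eq_norm_sq]
    have := norm_ne_zero_iff.2 h
    field_simp

theorem unitDir_smul {s : ℝ} (hs : 0 < s) (x : E) : unitDir (s • x) = unitDir x := by
  unfold unitDir
  rw [norm_smul, Real.norm_of_nonneg hs.le, smul_smul]
  congr 1
  field_simp

theorem inner_unitDir_le (x y : E) : ⟪x, unitDir y⟫ ≤ ‖x‖ :=
  (real_inner_le_norm _ _).trans (mul_le_of_le_one_right (norm_nonneg _) (norm_unitDir_le y))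

/-- The potential of a pair of vectors leading from two pursuers to the evader. It is small when
`x` is short and `y` is short and opposite to `x`. -/
noncomputable def pairPotential (M K : ℝ) (x y : E) : ℝ :=
  M * ‖x‖ + ((1 + K) * ‖y‖ + K * ⟪y, unitDir x⟫)

theorem norm_le_pairPotential {M K : ℝ} (hK : 0 ≤ K) (x y : E) :
    M * ‖x‖ + ‖y‖ ≤ pairPotential M K x y := by
  have h : -‖y‖ ≤ ⟪y, unitDir x⟫ := by
    have := inner_unitDir_le (-y) x
    rw [inner_neg_left, norm_neg] at this
    linarith
  unfold pairPotential
  nlinarith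

theorem pairPotential_nonneg {M K : ℝ} (hM : 0 ≤ M) (hK : 0 ≤ K) (x y : E) :
    0 ≤ pairPotential M K x y :=
  le_trans (by positivity) (norm_le_pairPotential hK x y)

/-- One step of pursuit along a straight line. -/
noncomputable def pursue (t : ℝ) (b : E) : E := (1 - t / ‖b‖) • b

theorem pairPotential_pursue {M K t : ℝ} {x y : E} (ht : 0 ≤ t) (hx : t < ‖x‖) (hy : t < ‖y‖) :
    pairPotential M K (pursue t x) (pursue t y) =
      M * (‖x‖ - t) + ((1 + K) * (‖y‖ - t) + K * (⟪y, unitDir x⟫ - t * ⟪unitDir y, unitDir x⟫)) := by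
  have key : ∀ z : E, t < ‖z‖ → 0 < 1 - t / ‖z‖ ∧ ‖pursue t z‖ = ‖z‖ - t := by
    intro z hz
    have hz0 : 0 < ‖z‖ := ht.trans_lt hz
    have h1 : 0 < 1 - t / ‖z‖ := by
      rw [sub_pos, div_lt_one hz0]; exact hz
    refine ⟨h1, ?_⟩
    unfold pursue
    rw [norm_smul, Real.norm_of_nonneg h1.le]
    field_simp
  unfold pairPotential
  rw [(key x hx).2, (key y hy).2]
  have : unitDir (pursue t x) = unitDir x := unitDir_smul (key x hx).1 x
  rw [this]
  have h2 : pursue t y = y - t • unitDir y := by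
    unfold pursue unitDir
    rw [sub_smul, one_smul, smul_smul, div_eq_mul_inv]
  rw [h2, inner_sub_left, real_inner_smul_left]

/-- A pursuer who gains little forces the evader to run almost straight away at full speed; the
deviation is of the order of the square root of the gain. -/
theorem norm_step_sub_sq_le {a v : E} {t : ℝ} (hv : ‖v‖ ≤ t) (h0 : a + v ≠ 0) :
    ‖v - t • unitDir (a + v)‖ ^ 2 ≤ 2 * t * (‖a‖ + t - ‖a + v‖) := by
  have h1 : ‖a + v‖ ≤ ‖a‖ + ⟪v, unitDir (a + v)⟫ := by
    rw [← inner_unitDir_self (a + v), inner_add_left]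
    linarith [inner_unitDir_le a (a + v)]
  have ht : 0 ≤ t := (norm_nonneg v).trans hv
  rw [norm_sub_sq_real, real_inner_smul_right, norm_smul, norm_unitDir h0,
    Real.norm_of_nonneg ht]
  nlinarith [norm_nonneg v]

theorem norm_mul_unitDir_sub_le {a v : E} {t : ℝ} (hv : ‖v‖ ≤ t) :
    ‖a‖ * ‖unitDir (a + v) - unitDir a‖ ≤
      (‖a‖ + t - ‖a + v‖) + ‖v - t • unitDir (a + v)‖ := by
  have hg : 0 ≤ ‖a‖ + t - ‖a + v‖ := by linarith [norm_add_le a v]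
  have e : ‖a‖ • (unitDir (a + v) - unitDir a) =
      (‖a‖ + t - ‖a + v‖) • unitDir (a + v) + (v - t • unitDir (a + v)) := by
    rw [smul_sub, norm_smul_unitDir, sub_smul, norm_smul_unitDir, add_smul]
    abel
  calc ‖a‖ * ‖unitDir (a + v) - unitDir a‖ = ‖‖a‖ • (unitDir (a + v) - unitDir a)‖ := by
        rw [norm_smul, norm_norm]
    _ ≤ _ := by
        rw [e]
        refine (norm_add_le _ _).trans (add_le_add_left ?_ _)
        rw [norm_smul, Real.norm_of_nonneg hg]
        exact mul_le_of_le_one_right hg (norm_unitDir_le _)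

/-- The worst case is a right angle, where Pythagoras already gives a gain proportional to `t`. -/
theorem gain_of_inner_nonpos {a u : E} {t ε T : ℝ} (hε : 0 < ε) (ha : ε ≤ ‖a‖) (ht : 0 ≤ t)
    (htT : t ≤ T) (hu : ‖u‖ ≤ 1) (hau : ⟪a, u⟫ ≤ 0) :
    ε / (ε + T) * t ≤ ‖a‖ + t - ‖a + t • u‖ := by
  have hT : 0 < ε + T := by linarith
  set s := ε / (ε + T) * t with hs
  have hsε : s * (ε + T) = ε * t := by rw [hs]; field_simp
  have hs0 : 0 ≤ s := by positivity
  have hst : s ≤ t := by nlinarith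
  have h1 : s * (‖a‖ + t) ≤ ‖a‖ * t := by nlinarith
  have h2 : ‖a + t • u‖ ^ 2 ≤ ‖a‖ ^ 2 + t ^ 2 := by
    rw [norm_add_sq_real, real_inner_smul_right, norm_smul, Real.norm_of_nonneg ht]
    have : (t * ‖u‖) ^ 2 ≤ t ^ 2 := by
      apply pow_le_pow_left₀ (by positivity)
      exact mul_le_of_le_one_right ht hu
    nlinarith
  have h3 : ‖a + t • u‖ ≤ ‖a‖ + t - s := by
    apply abs_le_of_sq_le_sq' _ _ |>.2
    · nlinarith
    · linarith [norm_nonneg a]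
  linarith

/-- With `g` the gain of the first pursuer and `z` the deviation of `v` from straight flight, the
second pursuer gains `η t` up to errors linear in `g` and `‖z‖`. Half of `η t` and the term `M g`
absorb these errors. -/
theorem pairPotential_pursue_le {a₁ a₂ v : E} {t ε A T K M η C₁ C : ℝ} (hε : 0 < ε) (hK : 0 ≤ K)
    (hη : η = ε / (ε + T)) (hC₁ : C₁ = (K * A + T) / ε) (hC : C = 2 * K + 1 + C₁)
    (hM : M = C ^ 2 / η + C₁)
    (ht : 0 < t) (htT : t ≤ T) (hv : ‖v‖ ≤ t) (h₁ : ε ≤ ‖a₁‖) (h₂ : ε ≤ ‖a₂‖) (hA : ‖a₂‖ ≤ A)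
    (hop : ⟪a₂, unitDir a₁⟫ ≤ 0) (hb₁ : t < ‖a₁ + v‖) (hb₂ : t < ‖a₂ + v‖) :
    pairPotential M K (pursue t (a₁ + v)) (pursue t (a₂ + v)) ≤
      pairPotential M K a₁ a₂ - η / 2 * t := by
  have hT : 0 < T := ht.trans_le htT
  have hη0 : 0 < η := by rw [hη]; positivity
  have hb₁0 : a₁ + v ≠ 0 := norm_pos_iff.1 (ht.trans hb₁)
  have hA0 : 0 < A := by linarith
  have hC₁0 : 0 ≤ C₁ := by rw [hC₁]; positivity
  have hz2 := norm_step_sub_sq_le hv hb₁0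
  have hud := norm_mul_unitDir_sub_le (a := a₁) hv
  have hgain := gain_of_inner_nonpos hε h₂ ht.le htT (norm_unitDir_le a₁) hop
  rw [← hη] at hgain
  have hg : 0 ≤ ‖a₁‖ + t - ‖a₁ + v‖ := by linarith [norm_add_le a₁ v]
  rw [pairPotential_pursue ht.le hb₁ hb₂]
  unfold pairPotential
  set u := unitDir a₁
  set u' := unitDir (a₁ + v)
  set w := unitDir (a₂ + v)
  set z := v - t • u' with hz
  set g := ‖a₁‖ + t - ‖a₁ + v‖ with hgdef
  have hvz : v = z + t • u' := by rw [hz]; abel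
  have d0 : ‖u' - u‖ * ε ≤ g + ‖z‖ := by nlinarith [norm_nonneg (u' - u)]
  -- gain of the second pursuer
  have e1 : ‖a₂ + v‖ ≤ ‖a₂ + t • u‖ + ‖z‖ + T * ‖u' - u‖ := by
    have : a₂ + v = (a₂ + t • u) + z + t • (u' - u) := by rw [hz, smul_sub]; abel
    rw [this]
    refine (norm_add_le _ _).trans (add_le_add (norm_add_le _ _) ?_)
    rw [norm_smul, Real.norm_of_nonneg ht.le]
    gcongr
  -- Added to `e3` with weight `K`, the terms in `t` and `t * ⟪w, u'⟫` cancel against the pursuit,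
  -- so the `K` part grows only by errors in `‖z‖` and `‖u' - u‖`.
  have e2 : ‖a₂ + v‖ ≤ ‖a₂‖ + t * ⟪w, u'⟫ + ‖z‖ := by
    have h3 : ‖a₂ + v‖ ≤ ‖a₂‖ + ⟪v, w⟫ := by
      rw [← inner_unitDir_self (a₂ + v), inner_add_left]
      linarith [inner_unitDir_le a₂ (a₂ + v)]
    have h4 : ⟪v, w⟫ = ⟪z, w⟫ + t * ⟪w, u'⟫ := by
      conv_lhs => rw [hvz]
      rw [inner_add_left, real_inner_smul_left, real_inner_comm w u']
    have h5 : ⟪z, w⟫ ≤ ‖z‖ := inner_unitDir_le _ _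
    linarith
  have e3 : ⟪a₂ + v, u'⟫ ≤ ⟪a₂, u⟫ + A * ‖u' - u‖ + t + ‖z‖ := by
    have h3 : ⟪a₂ + v, u'⟫ = ⟪a₂, u⟫ + ⟪a₂, u' - u⟫ + t * (‖u'‖ * ‖u'‖) + ⟪z, u'⟫ := by
      conv_lhs => rw [hvz]
      rw [inner_add_left, inner_add_left, real_inner_smul_left, inner_sub_right,
        real_inner_self_eq_norm_mul_norm]
      ring
    have h4 : ⟪a₂, u' - u⟫ ≤ A * ‖u' - u‖ :=
      (real_inner_le_norm _ _).trans (by gcongr)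
    have h5 : ⟪z, u'⟫ ≤ ‖z‖ := inner_unitDir_le _ _
    have h6 : ‖u'‖ * ‖u'‖ = 1 := by rw [norm_unitDir hb₁0]; norm_num
    rw [h3, h6]; linarith
  have d1 : (K * A + T) * ‖u' - u‖ ≤ C₁ * (g + ‖z‖) := by
    rw [hC₁, div_mul_eq_mul_div, le_div_iff₀ hε, mul_assoc]
    exact mul_le_mul_of_nonneg_left d0 (by positivity)
  -- The inequality of arithmetic and geometric means, with `‖z‖ ^ 2 ≤ 2 * t * g`; this dictates the
  -- choice of `M`.
  have d2 : C * ‖z‖ ≤ η / 2 * t + C ^ 2 / η * g := by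
    have h3 : C * ‖z‖ ≤ η / 2 * t + C ^ 2 * ‖z‖ ^ 2 / (2 * η * t) := by
      have : 0 ≤ (η * t - C * ‖z‖) ^ 2 / (2 * η * t) := by positivity
      have h4 : (η * t - C * ‖z‖) ^ 2 / (2 * η * t) =
          η / 2 * t + C ^ 2 * ‖z‖ ^ 2 / (2 * η * t) - C * ‖z‖ := by
        field_simp; ring
      linarith
    have h5 : C ^ 2 * ‖z‖ ^ 2 / (2 * η * t) ≤ C ^ 2 * (2 * t * g) / (2 * η * t) := by gcongr
    have h6 : C ^ 2 * (2 * t * g) / (2 * η * t) = C ^ 2 / η * g := by field_simp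
    linarith
  have e2' := mul_le_mul_of_nonneg_left e2 hK
  have e3' := mul_le_mul_of_nonneg_left e3 hK
  have hg' : ‖a₁ + v‖ = ‖a₁‖ + t - g := by rw [hgdef]; ring
  rw [hg', hM]
  have : C * ‖z‖ = 2 * K * ‖z‖ + ‖z‖ + C₁ * ‖z‖ := by rw [hC]; ring
  nlinarith

/-- Far out in the direction opposite to `a`, a bounded displacement `x` changes `‖y‖ + ⟪y, u⟫` only
by `O(1 / L)`, so the `K` term stays small. -/
theorem pairPotential_opposite_le {M K D L : ℝ} (hK : 0 ≤ K) (hDL : D < L)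
    {a x : E} (ha : a ≠ 0) (hx : ‖x‖ ≤ D) :
    pairPotential M K a (x - L • unitDir a) ≤
      M * ‖a‖ + (L + D + K * (D ^ 2 / (2 * (L - D)))) := by
  have hD : 0 ≤ D := (norm_nonneg x).trans hx
  have hu := norm_unitDir ha
  set u := unitDir a with hu_def
  set ρ := D ^ 2 / (2 * (L - D)) with hρ
  have hLD : 0 < L - D := by linarith
  have hρ0 : 0 ≤ ρ := by positivity
  have hρe : 2 * ρ * (L - D) = D ^ 2 := by rw [hρ]; field_simp
  set p := ⟪x, u⟫ with hp
  have hpD : p ≤ D := (inner_unitDir_le x a).trans hx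
  have h1 : ⟪x - L • u, u⟫ = p - L := by
    rw [inner_sub_left, real_inner_smul_left, real_inner_self_eq_norm_sq, hu]; ring
  have h2 : ‖x - L • u‖ ^ 2 = ‖x‖ ^ 2 - 2 * L * p + L ^ 2 := by
    rw [norm_sub_sq_real, real_inner_smul_right, norm_smul, hu, mul_one, Real.norm_eq_abs, sq_abs]
    ring
  have h3 : ‖x - L • u‖ ≤ L - p + ρ := by
    apply abs_le_of_sq_le_sq' _ _ |>.2
    · have : ‖x‖ ^ 2 ≤ D ^ 2 := pow_le_pow_left₀ (norm_nonneg x) hx 2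
      nlinarith [sq_nonneg ρ, sq_nonneg p]
    · linarith
  have h4 : ‖x - L • u‖ ≤ L + D := by
    refine (norm_sub_le _ _).trans ?_
    rw [norm_smul, hu, Real.norm_of_nonneg (by linarith)]
    linarith
  unfold pairPotential
  rw [← hu_def, h1]
  nlinarith
end

/-! ### Potentials and isometries in the general game -/

namespace CopsRobber
section

theorem valC_le_valR (X : Type*) [MetricSpace X] (k : ℕ) : valC X k ≤ valR X k :=
  iSup₂_mono fun _ _ => iSup_le fun p => iSup_le fun s => le_iInf fun q =>
    (iInf_le _ q).trans (le_iSup_of_le p (le_iSup_of_le s le_rfl))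

theorem exists_near_minimizer {α : Type*} (f : α → ℝ) (hf : ∀ a, 0 ≤ f a) {S : Set α}
    (hS : S.Nonempty) {δ : ℝ} (hδ : 0 < δ) : ∃ a ∈ S, ∀ b ∈ S, f a ≤ f b + δ := by
  have hne : (f '' S).Nonempty := hS.image f
  obtain ⟨_, ⟨a, ha, rfl⟩, h⟩ := exists_lt_of_csInf_lt hne (lt_add_of_pos_right (sInf (f '' S)) hδ)
  refine ⟨a, ha, fun b hb => h.le.trans ?_⟩
  gcongr
  exact csInf_le ⟨0, by rintro _ ⟨c, -, rfl⟩; exact hf c⟩ ⟨b, hb, rfl⟩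

variable {X : Type*} [MetricSpace X] {k : ℕ}

theorem not_isAgility_of_sum_le {τ : ℕ → ℝ≥0} {B : ℝ}
    (h : ∀ n, ∑ i ∈ Finset.range n, (τ i : ℝ) ≤ B) : ¬ IsAgility τ := by
  intro hτ
  have : ∑' n, (τ n : ℝ≥0∞) ≤ ENNReal.ofReal B := by
    refine ENNReal.tsum_le_of_sum_range_le fun n => ?_
    have e : ∑ i ∈ Finset.range n, (τ i : ℝ≥0∞) =
        ENNReal.ofReal (∑ i ∈ Finset.range n, (τ i : ℝ)) := by
      rw [ENNReal.ofReal_sum_of_nonneg fun _ _ => NNReal.coe_nonneg _]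
      simp
    rw [e]
    exact ENNReal.ofReal_le_ofReal (h n)
  rw [hτ, top_le_iff] at this
  exact ENNReal.ofReal_ne_top this

/-- A robber who can be made to lose potential in proportion to the length of each step as long as
he is not within `ε` of a cop comes within `ε` of a cop. -/
theorem valR_le_of_potential (Φ : X → (Fin k → X) → ℝ) (hΦ : ∀ r c, 0 ≤ Φ r c) {ε η : ℝ}
    (hη : 0 < η)
    (step : ∀ (r : X) (c : Fin k → X) (r' : X) (t : ℝ≥0), 0 < t → dist r r' ≤ t →
      (∀ i, ε < dist r (c i)) → ∃ c' : Fin k → X, (∀ i, dist (c i) (c' i) ≤ t) ∧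
        ((∃ i, dist r' (c' i) ≤ ε) ∨ Φ r' c' ≤ Φ r c - η * t)) :
    valR X k ≤ ENNReal.ofReal ε := by
  -- The cops see `r'` but not `r`, so they nearly minimize the potential over all legal replies,
  -- which competes with the reply from `step` for every `r`. The slack costs half of the decrease.
  have resp : ∀ (r' : X) (c : Fin k → X) (t : ℝ≥0), ∃ c' : Fin k → X,
      (∀ i, dist (c i) (c' i) ≤ t) ∧ ((∃ i, dist r' (c' i) ≤ ε) ∨
        ∀ c'' : Fin k → X, (∀ i, dist (c i) (c'' i) ≤ t) →
          (∀ i, ε < dist r' (c'' i)) ∧ Φ r' c' ≤ Φ r' c'' + η / 2 * t) := by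
    intro r' c t
    by_cases hcap : ∃ c' : Fin k → X, (∀ i, dist (c i) (c' i) ≤ t) ∧ ∃ i, dist r' (c' i) ≤ ε
    · obtain ⟨c', h1, h2⟩ := hcap
      exact ⟨c', h1, Or.inl h2⟩
    push Not at hcap
    -- For `t = 0` the slack vanishes, but there is only one legal reply.
    rcases eq_or_ne t 0 with rfl | ht
    · refine ⟨c, by simp, Or.inr fun c'' h => ⟨hcap c'' h, ?_⟩⟩
      have : c'' = c := funext fun i => (dist_le_zero.1 (by simpa using h i)).symm
      simp [this]
    · have ht' : 0 < t := pos_iff_ne_zero.2 ht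
      obtain ⟨c', h1, h2⟩ := exists_near_minimizer (Φ r') (hΦ r')
        (S := {c' | ∀ i, dist (c i) (c' i) ≤ t}) ⟨c, by simp⟩
        (δ := η / 2 * t) (by positivity)
      exact ⟨c', h1, Or.inr fun c'' h => ⟨hcap c'' h, h2 c'' h⟩⟩
  choose f hf using resp
  refine iSup₂_le fun τ hτ => iInf_le_of_le ⟨f, fun r' c t i => (hf r' c t).1 i⟩ ?_
  refine iSup₂_le fun p s => ?_
  by_contra! hlt
  set q : CopStrategy X k := ⟨f, fun r' c t i => (hf r' c t).1 i⟩
  have far : ∀ n i, ε < dist (position τ p s q n).1 ((position τ p s q n).2 i) := by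
    intro n i
    have := hlt.trans_le (iInf₂_le (f := fun n i => edist (position τ p s q n).1
      ((position τ p s q n).2 i)) n i)
    rw [edist_dist] at this
    exact (ENNReal.ofReal_lt_ofReal_iff').1 this |>.1
  have dec : ∀ n, Φ (position τ p s q (n + 1)).1 (position τ p s q (n + 1)).2 ≤
      Φ (position τ p s q n).1 (position τ p s q n).2 - η / 2 * τ n := by
    intro n
    have far1 := far (n + 1)
    have far0 := far n
    simp only [position] at far1 ⊢
    set x := position τ p s q n
    set r' := s.move x.1 x.2 (τ n)
    have hr : dist x.1 r' ≤ τ n := s.dist_move_le _ _ _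
    obtain ⟨hq1, hq2⟩ := hf r' x.2 (τ n)
    have hq3 := hq2.resolve_left fun ⟨i, hi⟩ => (far1 i).not_ge hi
    rcases eq_or_ne (τ n) 0 with h0 | h0
    · have e1 : r' = x.1 := (dist_le_zero.1 (by simpa [h0] using hr)).symm
      have e2 := (hq3 x.2 (by simp)).2
      rw [h0] at e2 ⊢
      rw [e1] at e2 ⊢
      simpa using e2
    · obtain ⟨c', hc1, hc2⟩ := step x.1 x.2 r' (τ n) (pos_iff_ne_zero.2 h0) hr far0
      obtain ⟨h1, h2⟩ := hq3 c' hc1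
      have h3 := hc2.resolve_left fun ⟨i, hi⟩ => (h1 i).not_ge hi
      change Φ r' (f r' x.2 (τ n)) ≤ _
      linarith
  have tot : ∀ n, Φ (position τ p s q n).1 (position τ p s q n).2 +
      η / 2 * ∑ i ∈ Finset.range n, (τ i : ℝ) ≤ Φ p.1 p.2 := by
    intro n
    induction n with
    | zero => simp [position]
    | succ n ih =>
      rw [Finset.sum_range_succ, mul_add]
      linarith [dec n]
  refine not_isAgility_of_sum_le (τ := τ) (B := Φ p.1 p.2 / (η / 2)) (fun n => ?_) hτ
  rw [le_div_iff₀ (by positivity)]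
  linarith [tot n, hΦ (position τ p s q n).1 (position τ p s q n).2]

/-- An isometry that moves every point by at least `2 a` lets the robber stay away from one cop: he
follows the image of the cop. -/
theorem le_valC_one_of_isometry (h : X ≃ᵢ X) {a : ℝ≥0} (ha : 0 < a) [Nonempty X]
    (hh : ∀ x, 2 * (a : ℝ) ≤ dist (h x) x) : (a : ℝ≥0∞) ≤ valC X 1 := by
  classical
  obtain ⟨x₀⟩ := ‹Nonempty X›
  let s : RobberStrategy X 1 :=
    -- The `else` branch only ensures legality; `near` shows that it is never taken in the play.
    { move := fun r c t => if dist r (h (c 0)) ≤ t then h (c 0) else r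
      dist_move_le := by
        intro r c t
        split_ifs with hd
        · exact hd
        · simp }
  have hτ : IsAgility fun _ => a := by
    unfold IsAgility
    exact ENNReal.tsum_const_eq_top_of_ne_zero (by simpa using ha.ne')
  refine le_iSup₂_of_le (fun _ => a) hτ <| le_iSup_of_le (h x₀, fun _ => x₀) <|
    le_iSup_of_le s <| le_iInf fun q => le_iInf₂ fun n i => ?_
  have near : ∀ n, dist (position (fun _ => a) (h x₀, fun _ => x₀) s q n).1
      (h ((position (fun _ => a) (h x₀, fun _ => x₀) s q n).2 0)) ≤ a := by
    intro n
    induction n with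
    | zero => simp [position]
    | succ n ih =>
      simp only [position]
      set x := position (fun _ => a) (h x₀, fun _ => x₀) s q n
      have : s.move x.1 x.2 a = h (x.2 0) := if_pos ih
      rw [this, h.dist_eq]
      exact q.dist_move_le _ _ _ _
  have hn := near n
  rw [Subsingleton.elim i 0]
  set x := position (fun _ => a) (h x₀, fun _ => x₀) s q n
  have h1 := hh (x.2 0)
  have h2 := dist_triangle_left (h (x.2 0)) (x.2 0) x.1
  rw [edist_dist, ← ENNReal.ofReal_coe_nnreal]
  exact ENNReal.ofReal_le_ofReal (by linarith)
end
end CopsRobber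

/-! ### Lifting to the universal cover of the torus -/

namespace FlatTorus
section
variable {n : ℕ}

/-- The covering map from Euclidean space to the flat torus. -/
noncomputable def proj (x : EuclideanSpace ℝ (Fin n)) : FlatTorus n :=
  WithLp.toLp 2 fun i => (x i : AddCircle (1 : ℝ))

theorem proj_add (x y : EuclideanSpace ℝ (Fin n)) : proj (x + y) = proj x + proj y := by
  ext i; simp [proj]

theorem proj_sub (x y : EuclideanSpace ℝ (Fin n)) : proj (x - y) = proj x - proj y := by
  ext i; simp [proj]

theorem norm_proj_le (x : EuclideanSpace ℝ (Fin n)) : ‖proj x‖ ≤ ‖x‖ := by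
  rw [PiLp.norm_eq_of_L2, PiLp.norm_eq_of_L2]
  refine Real.sqrt_le_sqrt (Finset.sum_le_sum fun i _ => ?_)
  exact pow_le_pow_left₀ (norm_nonneg _) QuotientAddGroup.norm_mk_le_norm 2

theorem exists_proj_eq_norm_eq (p : FlatTorus n) :
    ∃ x : EuclideanSpace ℝ (Fin n), proj x = p ∧ ‖x‖ = ‖p‖ := by
  have h : ∀ y : AddCircle (1 : ℝ), ∃ x : ℝ, (x : AddCircle (1 : ℝ)) = y ∧ ‖x‖ = ‖y‖ := by
    intro y
    obtain ⟨x, rfl⟩ := QuotientAddGroup.mk_surjective y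
    refine ⟨x - round x, ?_, ?_⟩
    · rw [AddCircle.coe_sub, sub_eq_self, AddCircle.coe_eq_zero_iff]
      exact ⟨round x, by simp⟩
    · exact UnitAddCircle.norm_eq.symm
  choose x hx using fun i => h (p i)
  refine ⟨WithLp.toLp 2 x, ?_, ?_⟩
  · ext i; exact (hx i).1
  · rw [PiLp.norm_eq_of_L2, PiLp.norm_eq_of_L2]
    simp [fun i => (hx i).2]

theorem norm_le (p : FlatTorus n) : ‖p‖ ≤ n := by
  rw [PiLp.norm_eq_of_L2]
  refine Real.sqrt_le_iff.2 ⟨by positivity, ?_⟩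
  have h : ∀ i, ‖p i‖ ^ 2 ≤ 1 := by
    intro i
    have := AddCircle.norm_le_half_period (1 : ℝ) (x := p i) one_ne_zero
    rw [abs_one] at this
    nlinarith [norm_nonneg (p i)]
  calc ∑ i, ‖p i‖ ^ 2 ≤ ∑ _i : Fin n, (1 : ℝ) := Finset.sum_le_sum fun i _ => h i
    _ = n := by simp
    _ ≤ (n : ℝ) ^ 2 := by exact_mod_cast Nat.le_self_pow two_ne_zero n

theorem exists_proj_eq_norm_sub_le (p : FlatTorus n) (y : EuclideanSpace ℝ (Fin n)) :
    ∃ x : EuclideanSpace ℝ (Fin n), ‖x‖ ≤ n ∧ proj (x - y) = p := by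
  obtain ⟨x, hx, hx'⟩ := exists_proj_eq_norm_eq (p + proj y)
  exact ⟨x, hx'.trans_le (norm_le _), by rw [proj_sub, hx, add_sub_cancel_right]⟩

/-- The potential of a pair of points of the torus: the infimum of the potentials of its lifts. -/
noncomputable def potential (M K : ℝ) (p q : FlatTorus n) : ℝ :=
  sInf {s | ∃ x y : EuclideanSpace ℝ (Fin n), proj x = p ∧ proj y = q ∧ pairPotential M K x y = s}

variable {M K : ℝ}

theorem potential_nonneg (hM : 0 ≤ M) (hK : 0 ≤ K) (p q : FlatTorus n) : 0 ≤ potential M K p q := by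
  refine Real.sInf_nonneg ?_
  rintro _ ⟨x, y, -, -, rfl⟩
  exact pairPotential_nonneg hM hK x y

theorem potential_proj_le (hM : 0 ≤ M) (hK : 0 ≤ K) (x y : EuclideanSpace ℝ (Fin n)) :
    potential M K (proj x) (proj y) ≤ pairPotential M K x y := by
  refine csInf_le ⟨0, ?_⟩ ⟨x, y, rfl, rfl, rfl⟩
  rintro _ ⟨x, y, -, -, rfl⟩
  exact pairPotential_nonneg hM hK x y

theorem exists_lift_potential (p q : FlatTorus n) {δ : ℝ} (hδ : 0 < δ) :
    ∃ x y : EuclideanSpace ℝ (Fin n), proj x = p ∧ proj y = q ∧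
      pairPotential M K x y < potential M K p q + δ := by
  obtain ⟨x, hx, -⟩ := exists_proj_eq_norm_eq p
  obtain ⟨y, hy, -⟩ := exists_proj_eq_norm_eq q
  obtain ⟨_, ⟨x, y, hx, hy, rfl⟩, h⟩ := exists_lt_of_csInf_lt
    (⟨_, x, y, hx, hy, rfl⟩ : {s | ∃ x y : EuclideanSpace ℝ (Fin n), proj x = p ∧ proj y = q ∧
      pairPotential M K x y = s}.Nonempty) (lt_add_of_pos_right (potential M K p q) hδ)
  exact ⟨x, y, hx, hy, h⟩

/-- In a nearly optimal pair of lifts the second vector is bounded and does not point into the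
direction of the first one. -/
theorem norm_le_and_inner_nonpos_of_lift (hn : 1 ≤ n) {ε L : ℝ} (hε : 0 < ε) (hM : 0 ≤ M)
    (hL : L = n + n ^ 2 / ε) (hKL : K = 2 * (L + n + 1) / ε) {x y : EuclideanSpace ℝ (Fin n)}
    (hx : x ≠ 0) (hy : ε ≤ ‖y‖)
    (h : pairPotential M K x y ≤ potential M K (proj x) (proj y) + 1) :
    ‖y‖ ≤ 2 * (L + n + 1) ∧ ⟪y, unitDir x⟫ ≤ 0 := by
  have hn' : (1 : ℝ) ≤ n := by exact_mod_cast hn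
  have hn₀ : (0 : ℝ) < n := one_pos.trans_le hn'
  have hnL : (n : ℝ) < L := by rw [hL, lt_add_iff_pos_right]; positivity
  have hL₀ : 0 < L := hn₀.trans hnL
  have hK : 0 < K := by rw [hKL]; positivity
  have hKε : K * ε = 2 * (L + n + 1) := by rw [hKL]; field_simp
  -- Thus the opposite lift has `K` term at most `K * ε / 2 = L + n + 1`, whereas `⟪y, unitDir x⟫ >
  -- 0` would cost more than `K * ε`.
  have hρ : (n : ℝ) ^ 2 / (2 * (L - n)) = ε / 2 := by
    rw [hL, add_sub_cancel_left]; field_simp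
  obtain ⟨z, hz, hzy⟩ := exists_proj_eq_norm_sub_le (proj y) (L • unitDir x)
  have h1 := pairPotential_opposite_le (M := M) hK.le hnL hx hz
  have h2 := potential_proj_le hM hK.le x (z - L • unitDir x)
  rw [hzy] at h2
  rw [hρ] at h1
  constructor
  · have := norm_le_pairPotential (M := M) hK.le x y
    linarith
  · by_contra! hpos
    rw [pairPotential] at h
    have := mul_pos hK hpos
    nlinarith

theorem proj_pursue (r' c : FlatTorus n) {b : EuclideanSpace ℝ (Fin n)} (hb : proj b = r' - c)
    {t : ℝ} (ht : 0 ≤ t) : ∃ c' : FlatTorus n, dist c c' ≤ t ∧ r' - c' = proj (pursue t b) := by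
  refine ⟨c + proj ((t / ‖b‖) • b), ?_, ?_⟩
  · rw [dist_self_add_right]
    refine (norm_proj_le _).trans ?_
    rw [norm_smul, Real.norm_of_nonneg (by positivity)]
    rcases eq_or_ne ‖b‖ 0 with h | h
    · simp [h, ht]
    · rw [div_mul_cancel₀ _ h]
  · unfold pursue
    rw [sub_smul, one_smul, proj_sub, hb]
    abel

theorem valR_two_eq_zero (hn : 1 ≤ n) : CopsRobber.valR (FlatTorus n) 2 = 0 := by
  have main : ∀ ε : ℝ, 0 < ε → CopsRobber.valR (FlatTorus n) 2 ≤ ENNReal.ofReal ε := by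
    intro ε hε
    have hn' : (1 : ℝ) ≤ n := by exact_mod_cast hn
    obtain ⟨L, hL⟩ : ∃ L : ℝ, L = n + n ^ 2 / ε := ⟨_, rfl⟩
    have hL0 : 0 < L := by rw [hL]; positivity
    obtain ⟨K, hK⟩ : ∃ K : ℝ, K = 2 * (L + n + 1) / ε := ⟨_, rfl⟩
    have hK0 : 0 < K := by rw [hK]; positivity
    obtain ⟨η, hη⟩ : ∃ η : ℝ, η = ε / (ε + n) := ⟨_, rfl⟩
    have hη0 : 0 < η := by rw [hη]; positivity
    obtain ⟨C₁, hC₁⟩ : ∃ C₁ : ℝ, C₁ = (K * (2 * (L + n + 1)) + n) / ε := ⟨_, rfl⟩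
    have hC₁0 : 0 < C₁ := by rw [hC₁]; positivity
    obtain ⟨C, hC⟩ : ∃ C : ℝ, C = 2 * K + 1 + C₁ := ⟨_, rfl⟩
    obtain ⟨M, hM⟩ : ∃ M : ℝ, M = C ^ 2 / η + C₁ := ⟨_, rfl⟩
    have hM0 : 0 ≤ M := by rw [hM]; positivity
    refine CopsRobber.valR_le_of_potential (fun r c => potential M K (r - c 0) (r - c 1))
      (fun r c => potential_nonneg hM0 hK0.le _ _) (η := η / 4) (by positivity) ?_
    intro r c r' t ht hr hfar
    have ht' : (0 : ℝ) < t := ht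
    by_cases hcap : ∃ i, dist r' (c i) ≤ t
    · obtain ⟨i, hi⟩ := hcap
      refine ⟨Function.update c i r', fun j => ?_, Or.inl ⟨i, by simp [hε.le]⟩⟩
      rcases eq_or_ne j i with rfl | hj
      · simpa [dist_comm] using hi
      · simp [hj]
    push Not at hcap
    -- Longer steps reach the robber at once, so `n` serves as the bound `T`.
    have htn : (t : ℝ) ≤ n := by
      refine (hcap 0).le.trans ?_
      rw [dist_eq_norm]; exact norm_le _
    -- The slack `1` keeps the second vector well placed; the slack `η / 4 * t` leaves half of the
    -- drop `η / 2 * t`.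
    obtain ⟨a₁, a₂, ha₁, ha₂, ha⟩ := exists_lift_potential (M := M) (K := K) (r - c 0) (r - c 1)
      (δ := min 1 (η / 4 * t)) (by positivity)
    obtain ⟨v, hv, hvr⟩ := exists_proj_eq_norm_eq (r' - r)
    have hvt : ‖v‖ ≤ t := by rw [hvr, ← dist_eq_norm, dist_comm]; exact hr
    have lift : ∀ (a : EuclideanSpace ℝ (Fin n)) (i : Fin 2), proj a = r - c i →
        ε ≤ ‖a‖ ∧ proj (a + v) = r' - c i ∧ t < ‖a + v‖ := by
      intro a i hai
      have e : proj (a + v) = r' - c i := by rw [proj_add, hai, hv]; abel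
      refine ⟨?_, e, ?_⟩
      · have := hfar i
        rw [dist_eq_norm, ← hai] at this
        exact this.le.trans (norm_proj_le a)
      · have := hcap i
        rw [dist_eq_norm, ← e] at this
        exact this.trans_le (norm_proj_le _)
    obtain ⟨hε₁, hb₁, ht₁⟩ := lift a₁ 0 ha₁
    obtain ⟨hε₂, hb₂, ht₂⟩ := lift a₂ 1 ha₂
    have ha₁0 : a₁ ≠ 0 := norm_pos_iff.1 (hε.trans_le hε₁)
    obtain ⟨hA, hop⟩ := norm_le_and_inner_nonpos_of_lift hn hε hM0 hL hK ha₁0 hε₂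
      (by rw [ha₁, ha₂]; linarith [min_le_left 1 (η / 4 * t)])
    have key := pairPotential_pursue_le hε hK0.le hη hC₁ hC hM ht' htn hvt hε₁ hε₂ hA hop ht₁ ht₂
    obtain ⟨c₁, hc₁, hc₁'⟩ := proj_pursue r' (c 0) hb₁ ht'.le
    obtain ⟨c₂, hc₂, hc₂'⟩ := proj_pursue r' (c 1) hb₂ ht'.le
    refine ⟨![c₁, c₂], ?_, Or.inr ?_⟩
    · intro i
      fin_cases i
      · exact hc₁
      · exact hc₂
    · change potential M K (r' - c₁) (r' - c₂) ≤ _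
      rw [hc₁', hc₂']
      have := potential_proj_le hM0 hK0.le (pursue (t : ℝ) (a₁ + v)) (pursue (t : ℝ) (a₂ + v))
      linarith [min_le_right 1 (η / 4 * t)]
  refine le_antisymm (le_of_forall_gt_imp_ge_of_dense fun b hb => ?_) zero_le
  rcases eq_or_ne b ⊤ with rfl | hb'
  · exact le_top
  · have := main b.toReal (ENNReal.toReal_pos hb.ne' hb')
    rwa [ENNReal.ofReal_toReal hb'] at this

theorem valC_one_pos (hn : 1 ≤ n) : 0 < CopsRobber.valC (FlatTorus n) 1 := by
  let w : FlatTorus n := WithLp.toLp 2 fun _ => ((1 / 2 : ℝ) : AddCircle (1 : ℝ))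
  have hw : 1 / 2 ≤ ‖w‖ := by
    refine le_trans ?_ (PiLp.norm_apply_le w ⟨0, hn⟩)
    exact ((AddCircle.norm_half_period_eq (1 : ℝ)).trans (by norm_num)).ge
  have := CopsRobber.le_valC_one_of_isometry (IsometryEquiv.addLeft w) (a := 1 / 4) (by norm_num)
    (fun x => by
      rw [IsometryEquiv.addLeft_apply, dist_add_self_left]
      refine le_trans ?_ hw
      norm_num)
  refine lt_of_lt_of_le ?_ this
  simp
end
end FlatTorus

theorem mainTheorem2 (n : ℕ) (hn : 1 ≤ n) :
    CopsRobber.copNumber (FlatTorus n) = 2 ∧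
      IsLeast {k : ℕ | 1 ≤ k ∧ CopsRobber.valR (FlatTorus n) k = 0} 2 := by
  have hC : 0 < CopsRobber.valC (FlatTorus n) 1 := FlatTorus.valC_one_pos hn
  have hR := FlatTorus.valR_two_eq_zero hn
  have two_le : ∀ k : ℕ, 1 ≤ k → CopsRobber.valC (FlatTorus n) k = 0 → 2 ≤ k := by
    intro k hk h0
    by_contra! hlt
    obtain rfl : k = 1 := by omega
    exact hC.ne' h0
  refine ⟨le_antisymm ?_ ?_, ⟨one_le_two, hR⟩, fun k hk => two_le k hk.1 ?_⟩
  · exact iInf₂_le_of_le 2 ⟨one_le_two,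
      le_antisymm ((CopsRobber.valC_le_valR _ _).trans hR.le) zero_le⟩ le_rfl
  · refine le_iInf₂ fun k hk => ?_
    exact_mod_cast two_le k hk.1 hk.2
  · exact le_antisymm ((CopsRobber.valC_le_valR _ _).trans hk.2.le) zero_le
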